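/- **Theorem 1.1.** Let $\kappa$ be a strongly compact cardinal (uncountable, regular, and such that every proper $\kappa$-complete filter on a set extends to a $\kappa$-complete ultrafilter), let $(K,\prec_K)$ be an abstract elementary class in a vocabulary $\tau$ with Löwenheim–Skolem number $LS(K)<\kappa$ (where, as usual, $LS(K)\ge|\tau|+\aleph_0$), and let $\mu<\kappa$ be a cardinal. If $P$ is any one of the properties AP, JEP, DAP, DJEP, NDJEP below and $K$ has $P$ for models with cardinality in $[\mu,\kappa)$, then $K$ has $P$ for all models of cardinality $\geq\mu$. Here a $K$-embedding is an embedding of $\tau$-structures whose image is a strong substructure ($\prec_K$) of its codomain, and for a class $\mathcal F$ of cardinals $K_{\mathcal F}$ is the class of $M\in K$ with $|M|\in\mathcal F$. For models with cardinality in $\mathcal F$: * **AP** (amalgamation): for all $M_0,M_1,M_2\in K_{\mathcal F}$ and $K$-embeddings $f_\ell:M_0\to M_\ell$ ($\ell=1,2$) there are $N\in K$ and $K$-embeddings $g_\ell:M_\ell\to N$ with $g_1f_1=g_2f_2$. * **DAP** (disjoint amalgamation): the same, with in addition $g_1(M_1)\cap g_2(M_2)=g_1f_1(M_0)$. * **JEP**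 (joint embedding): for all $M_1,M_2\in K_{\mathcal F}$ there are $N\in K$ and $K$-embeddings $g_\ell:M_\ell\to N$. * **DJEP** (disjoint joint embedding): the same, with in addition $g_1(M_1)\cap g_2(M_2)=\emptyset$. * **NDJEP** (nearly disjoint joint embedding): as JEP, with in addition $g_1(M_1)\cap g_2(M_2)$ contained in the set of values in $N$ of the closed $\tau$-terms. -/

import Mathlib

open Cardinal
open scoped FirstOrder

universe u

/-- `κ` is strongly compact: it is an uncountable regular cardinal and every (proper)
`κ`-complete filter on any set extends to a `κ`-complete ultrafilter. -/
structure IsStronglyCompact (κ : Cardinal.{u}) : Prop where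
  aleph0_lt : ℵ₀ < κ
  isRegular : κ.IsRegular
  exists_ultrafilter : ∀ (S : Type u) (F : Filter S), F.NeBot → CardinalInterFilter F κ →
    ∃ U : Ultrafilter S, (U : Filter S) ≤ F ∧ CardinalInterFilter (U : Filter S) κ

/-- For substructures `S`, `T` of one `L`-structure: `S ⊆ T`, and `S`, seen as a substructure of
the structure `T`, satisfies the given relation `R` (`R A` reads: `A` is a strong
substructure of the structure it lives in). -/
def StrongWithin {L : FirstOrder.Language.{u, u}}
    (R : {N : Type u} → [L.Structure N] → L.Substructure N → Prop)
    {N : Type u} [L.Structure N] (S T : L.Substructure N) : Prop :=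
  S ≤ T ∧ R (S.comap T.subtype.toHom)

/-- An abstract elementary class in the vocabulary `L`: a class `Mod` of `L`-structures together
with a strong substructure relation `≺` (`Strong S`, for a substructure `S` of `N`,
reads `S ≺ N`), satisfying the usual axioms. -/
structure AEC (L : FirstOrder.Language.{u, u}) where
  /-- membership of an `L`-structure in the class -/
  Mod : (M : Type u) → [L.Structure M] → Prop
  /-- the strong substructure relation `S ≺ N` -/
  Strong : {N : Type u} → [L.Structure N] → L.Substructure N → Prop
  /-- `≺` relates members of the class only -/
  mod_of_strong : ∀ {N : Type u} [L.Structure N] (S : L.Substructure N),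
    Strong S → Mod S ∧ Mod N
  /-- the class is closed under isomorphism -/
  mod_of_equiv : ∀ {M N : Type u} [L.Structure M] [L.Structure N],
    (M ≃[L] N) → Mod M → Mod N
  /-- `≺` is closed under isomorphism -/
  strong_of_equiv : ∀ {M N : Type u} [L.Structure M] [L.Structure N] (e : M ≃[L] N)
    (S : L.Substructure M), Strong S → Strong (S.map e.toHom)
  /-- `≺` is reflexive on the class -/
  strong_refl : ∀ {N : Type u} [L.Structure N], Mod N → Strong (⊤ : L.Substructure N)
  /-- `≺` is transitive -/
  strong_trans : ∀ {N : Type u} [L.Structure N] (S T : L.Substructure N),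
    StrongWithin Strong S T → Strong T → Strong S
  /-- coherence: if `S ≺ N`, `T ≺ N` and `S ⊆ T`, then `S ≺ T` -/
  coherence : ∀ {N : Type u} [L.Structure N] (S T : L.Substructure N),
    Strong S → Strong T → S ≤ T → StrongWithin Strong S T
  /-- the union of a continuous well-ordered `≺`-increasing chain is in the class and is a
  strong extension of each member of the chain (the chain is realized as a chain of
  substructures of some `L`-structure, which need not be in the class) -/
  chain_union : ∀ {N : Type u} [L.Structure N] {ι : Type u} [LinearOrder ι] [WellFoundedLT ι]
    [Nonempty ι] (S : ι → L.Substructure N),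
    (∀ i j, i ≤ j → StrongWithin Strong (S i) (S j)) →
    (∀ i, Order.IsSuccLimit i → S i = ⨆ j : Set.Iio i, S j) →
    Mod (⨆ i, S i : L.Substructure N) ∧ ∀ i, StrongWithin Strong (S i) (⨆ i, S i)
  /-- if moreover each member of the chain is `≺ N`, then so is the union -/
  chain_union_strong : ∀ {N : Type u} [L.Structure N] {ι : Type u} [LinearOrder ι]
    [WellFoundedLT ι] [Nonempty ι] (S : ι → L.Substructure N),
    (∀ i j, i ≤ j → StrongWithin Strong (S i) (S j)) →
    (∀ i, Order.IsSuccLimit i → S i = ⨆ j : Set.Iio i, S j) →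
    (∀ i, Strong (S i)) → Strong (⨆ i, S i)
  /-- downward Löwenheim–Skolem: some cardinal serves as a Löwenheim–Skolem number -/
  exists_ls : ∃ lam : Cardinal.{u}, ∀ {N : Type u} [L.Structure N], Mod N → ∀ A : Set N,
    ∃ S : L.Substructure N, Strong S ∧ A ⊆ S ∧ #S ≤ #A + lam

namespace AEC

variable {L : FirstOrder.Language.{u, u}}

/-- The Löwenheim–Skolem number of `K`: the least infinite cardinal `lam`, at least the size of the
vocabulary, such that every subset `A` of a model `N` of `K` is contained in
some `S ≺ N` with `|S| ≤ |A| + lam`. -/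
noncomputable def lsNumber (K : AEC L) : Cardinal.{u} :=
  sInf {lam : Cardinal.{u} | ℵ₀ ≤ lam ∧ L.card ≤ lam ∧
    ∀ (N : Type u) [L.Structure N], K.Mod N → ∀ A : Set N,
      ∃ S : L.Substructure N, K.Strong S ∧ A ⊆ S ∧ #S ≤ #A + lam}

/-- An `L`-embedding is a `K`-embedding if its range is a strong substructure of its codomain. -/
def IsKEmbedding (K : AEC L) {M N : Type u} [L.Structure M] [L.Structure N]
    (f : M ↪[L] N) : Prop :=
  K.Strong f.toHom.range

/-- Amalgamation property for the models of `K` with cardinality in `C`. -/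
def AP (K : AEC L) (C : Set Cardinal.{u}) : Prop :=
  ∀ (M₀ M₁ M₂ : Type u) [L.Structure M₀] [L.Structure M₁] [L.Structure M₂],
    K.Mod M₀ → K.Mod M₁ → K.Mod M₂ → #M₀ ∈ C → #M₁ ∈ C → #M₂ ∈ C →
    ∀ (f₁ : M₀ ↪[L] M₁) (f₂ : M₀ ↪[L] M₂), K.IsKEmbedding f₁ → K.IsKEmbedding f₂ →
    ∃ (N : Type u) (_ : L.Structure N) (g₁ : M₁ ↪[L] N) (g₂ : M₂ ↪[L] N),
      K.IsKEmbedding g₁ ∧ K.IsKEmbedding g₂ ∧ g₁.comp f₁ = g₂.comp f₂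

/-- Disjoint amalgamation property for the models of `K` with cardinality in `C`: the ranges of the
amalgamating embeddings meet only in the image of the base. -/
def DAP (K : AEC L) (C : Set Cardinal.{u}) : Prop :=
  ∀ (M₀ M₁ M₂ : Type u) [L.Structure M₀] [L.Structure M₁] [L.Structure M₂],
    K.Mod M₀ → K.Mod M₁ → K.Mod M₂ → #M₀ ∈ C → #M₁ ∈ C → #M₂ ∈ C →
    ∀ (f₁ : M₀ ↪[L] M₁) (f₂ : M₀ ↪[L] M₂), K.IsKEmbedding f₁ → K.IsKEmbedding f₂ →
    ∃ (N : Type u) (_ : L.Structure N) (g₁ : M₁ ↪[L] N) (g₂ : M₂ ↪[L] N),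
      K.IsKEmbedding g₁ ∧ K.IsKEmbedding g₂ ∧ g₁.comp f₁ = g₂.comp f₂ ∧
      Set.range g₁ ∩ Set.range g₂ = Set.range (g₁.comp f₁)

/-- Joint embedding property for the models of `K` with cardinality in `C`. -/
def JEP (K : AEC L) (C : Set Cardinal.{u}) : Prop :=
  ∀ (M₁ M₂ : Type u) [L.Structure M₁] [L.Structure M₂],
    K.Mod M₁ → K.Mod M₂ → #M₁ ∈ C → #M₂ ∈ C →
    ∃ (N : Type u) (_ : L.Structure N) (g₁ : M₁ ↪[L] N) (g₂ : M₂ ↪[L] N),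
      K.IsKEmbedding g₁ ∧ K.IsKEmbedding g₂

/-- Disjoint joint embedding property for the models of `K` with cardinality in `C`. -/
def DJEP (K : AEC L) (C : Set Cardinal.{u}) : Prop :=
  ∀ (M₁ M₂ : Type u) [L.Structure M₁] [L.Structure M₂],
    K.Mod M₁ → K.Mod M₂ → #M₁ ∈ C → #M₂ ∈ C →
    ∃ (N : Type u) (_ : L.Structure N) (g₁ : M₁ ↪[L] N) (g₂ : M₂ ↪[L] N),
      K.IsKEmbedding g₁ ∧ K.IsKEmbedding g₂ ∧ Disjoint (Set.range g₁) (Set.range g₂)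

/-- Nearly disjoint joint embedding property for the models of `K` with cardinality in `C`: the
ranges meet only in elements named by closed terms, which no embeddings can separate. -/
def NDJEP (K : AEC L) (C : Set Cardinal.{u}) : Prop :=
  ∀ (M₁ M₂ : Type u) [L.Structure M₁] [L.Structure M₂],
    K.Mod M₁ → K.Mod M₂ → #M₁ ∈ C → #M₂ ∈ C →
    ∃ (N : Type u) (_ : L.Structure N) (g₁ : M₁ ↪[L] N) (g₂ : M₂ ↪[L] N),
      K.IsKEmbedding g₁ ∧ K.IsKEmbedding g₂ ∧
      Set.range g₁ ∩ Set.range g₂ ⊆ (FirstOrder.Language.Substructure.closure L (∅ : Set N) : Set N)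

end AEC

/-! Fix a fine `κ`-complete ultrafilter on the set `P_κ(M₁ ⊔ M₂)` of small subsets of the models to
be amalgamated. Each index `Y` is contained in strong submodels of `M₁` and `M₂` of size in
`[μ, κ)`; amalgamate those, and take the ultraproduct of the amalgams. By fineness each element of
`M₁` and `M₂` lies in almost all of the submodels, so both models embed into the ultraproduct, and
the identifications that must or may take place are inherited from the coordinates.

The embeddings are `K`-embeddings because `K` is closed under `κ`-complete ultraproducts. Indeed an
ultraproduct of models is the directed union of the ultraproducts of their strong submodels of size
at most `LS(K)`; these have size less than `κ`, so any two of them are copied faithfully into almost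
every coordinate, which decides the strong substructure relation between them. Closure under
directed unions follows from the chain axioms by induction on the size of the index set. -/

theorem exists_forall_mem_finset_lt {X : Type*} [Preorder X] [IsDirectedOrder X] [Nonempty X]
    [NoMaxOrder X] (s : Finset X) : ∃ a, ∀ x ∈ s, x < a := by
  obtain ⟨b, hb⟩ := s.exists_le
  obtain ⟨a, hba⟩ := exists_gt b
  exact ⟨a, fun x hx => (hb x hx).trans_lt hba⟩

theorem exists_finset_map_subtype_eq {X : Type*} {p : X → Prop} {s : Finset X}
    (hs : ∀ x ∈ s, p x) :
    ∃ t : Finset {x // p x}, t.map (.subtype _) = s := by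
  classical exact ⟨s.subtype p, Finset.subtype_map_of_mem hs⟩

/-- The supremum of the values of `S` at the finite sets of elements below `a`. -/
def iSupFinsetBelow {X α : Type*} [LT X] [CompleteLattice α] (S : Finset X → α) (a : X) : α :=
  ⨆ t : Finset {x // x < a}, S (t.map (.subtype _))

section FinsetBelow

variable {X α : Type*} [Preorder X] [CompleteLattice α] (S : Finset X → α)

theorem le_iSupFinsetBelow {s : Finset X} {a : X} (hs : ∀ x ∈ s, x < a) :
    S s ≤ iSupFinsetBelow S a := by
  obtain ⟨t, rfl⟩ := exists_finset_map_subtype_eq hs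
  exact le_iSup (fun t : Finset {x // x < a} => S (t.map (.subtype _))) t

theorem iSupFinsetBelow_mono : Monotone (iSupFinsetBelow S) := fun _ _ hab =>
  iSup_le fun _ => le_iSupFinsetBelow S (Finset.forall_mem_map.2 fun x _ => x.2.trans_le hab)

theorem iSup_iSupFinsetBelow [IsDirectedOrder X] [NoMaxOrder X] [Nonempty X] :
    ⨆ a, iSupFinsetBelow S a = ⨆ s, S s := by
  refine le_antisymm (iSup_le fun a => iSup_le fun t => le_iSup S _) (iSup_le fun s => ?_)
  obtain ⟨a, ha⟩ := exists_forall_mem_finset_lt s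
  exact (le_iSupFinsetBelow S ha).trans (le_iSup (iSupFinsetBelow S) a)

theorem iSupFinsetBelow_of_isSuccLimit {X : Type*} [LinearOrder X] (S : Finset X → α) {a : X}
    (ha : Order.IsSuccLimit a) :
    iSupFinsetBelow S a = ⨆ b : Set.Iio a, iSupFinsetBelow S b := by
  refine le_antisymm (iSup_le fun t => ?_) (iSup_le fun b => iSupFinsetBelow_mono S b.2.le)
  have := ha.isSuccPrelimit.noMaxOrder_Iio
  have : Nonempty (Set.Iio a) := (not_isMin_iff.1 ha.1).elim fun b hb => ⟨⟨b, hb⟩⟩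
  obtain ⟨b, hb⟩ := exists_forall_mem_finset_lt (X := Set.Iio a) t
  exact (le_iSupFinsetBelow S (Finset.forall_mem_map.2 hb)).trans
    (le_iSup (fun b : Set.Iio a => iSupFinsetBelow S b) b)

end FinsetBelow

/-- This lets a directed family be reindexed by the finite subsets of its index set. -/
theorem exists_monotone_finset_upperBound (X : Type*) [Preorder X] [IsDirectedOrder X]
    [Nonempty X] : ∃ F : Finset X → X, Monotone F ∧ ∀ s, ∀ x ∈ s, x ≤ F s := by
  classical
  have hstep : ∀ (s : Finset X) (F : ∀ t ⊂ s, X),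
      ∃ y, (∀ x ∈ s, x ≤ y) ∧ ∀ t (ht : t ⊂ s), F t ht ≤ y := by
    intro s F
    obtain ⟨y, hy⟩ := Finset.exists_le (s ∪ s.ssubsets.attach.image
      fun t : {t // t ∈ s.ssubsets} => F t.1 (Finset.mem_ssubsets.1 t.2))
    refine ⟨y, fun x hx => hy x (Finset.mem_union_left _ hx), fun t ht => hy _ ?_⟩
    exact Finset.mem_union_right _ (Finset.mem_image.2
      ⟨⟨t, Finset.mem_ssubsets.2 ht⟩, Finset.mem_attach _ _, rfl⟩)
  choose H hH_le hH_mono using hstep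
  have hF := Finset.strongInduction_eq H
  refine ⟨Finset.strongInduction H, fun s t hst => ?_, fun s x hx => ?_⟩
  · rcases hst.eq_or_ssubset with rfl | hst
    · exact le_rfl
    · exact (hF t).symm ▸ hH_mono t (fun t _ => Finset.strongInduction H t) s hst
  · exact (hF s).symm ▸ hH_le s _ x hx

/-- The set `P_κ(X)` of subsets of `X` with fewer than `κ` elements, ordered by inclusion. -/
abbrev SmallSubset (κ : Cardinal.{u}) (X : Type u) : Type u := {Y : Set X // #Y < κ}

open Filter in
theorem IsStronglyCompact.exists_fine_ultrafilter {κ : Cardinal.{u}} (hκ : IsStronglyCompact κ)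
    (X : Type u) :
    ∃ U : Ultrafilter (SmallSubset κ X), CardinalInterFilter (U : Filter (SmallSubset κ X)) κ ∧
      ∀ x, ∀ᶠ Y : SmallSubset κ X in U, x ∈ Y.1 := by
  have hω := hκ.aleph0_lt
  have : Nonempty (SmallSubset κ X) := ⟨⟨∅, by simpa using aleph0_pos.trans hω⟩⟩
  have : IsDirectedOrder (SmallSubset κ X) := ⟨fun Y Z =>
    ⟨⟨Y ∪ Z, (mk_union_le _ _).trans_lt (add_lt_of_lt hω.le Y.2 Z.2)⟩,
      Set.subset_union_left, Set.subset_union_right⟩⟩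
  have hcomplete : CardinalInterFilter (atTop : Filter (SmallSubset κ X)) κ := by
    refine ⟨fun S hS h => ?_⟩
    choose Y hY using fun s : S => mem_atTop_sets.1 (h s s.2)
    have hcard : #(⋃ s, (Y s).1) < κ :=
      (card_iUnion_lt_iff_forall_of_isRegular hκ.isRegular hS).2 fun s => (Y s).2
    exact mem_atTop_sets.2 ⟨⟨_, hcard⟩, fun Z hZ s hs =>
      hY ⟨s, hs⟩ Z ((Set.subset_iUnion (fun s => (Y s).1) ⟨s, hs⟩).trans hZ)⟩
  obtain ⟨U, hU, hUκ⟩ := hκ.exists_ultrafilter _ atTop inferInstance hcomplete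
  refine ⟨U, hUκ, fun x => hU ?_⟩
  have hx : #({x} : Set X) < κ := (mk_singleton x).trans_lt (one_lt_aleph0.trans hω)
  exact (eventually_ge_atTop (⟨{x}, hx⟩ : SmallSubset κ X)).mono fun Y hY => hY rfl

section Ultraproduct

open FirstOrder FirstOrder.Language Filter

variable {L : FirstOrder.Language.{u, u}} {I : Type u} {U : Ultrafilter I} {N : I → Type u}

variable (U) in
/-- The class in the ultraproduct of an element of the product. -/
def toUltraproduct (f : ∀ i, N i) : (U : Filter I).Product N := (f : (U : Filter I).Product N)

theorem toUltraproduct_surjective : Function.Surjective (toUltraproduct U (N := N)) :=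
  Quot.mk_surjective

theorem toUltraproduct_eq_iff {f g : ∀ i, N i} :
    toUltraproduct U f = toUltraproduct U g ↔ ∀ᶠ i in U, f i = g i :=
  Quotient.eq''

section Structure

variable [∀ i, L.Structure (N i)]

theorem funMap_toUltraproduct {n : ℕ} (F : L.Functions n) (x : Fin n → ∀ i, N i) :
    Structure.funMap F (fun k => toUltraproduct U (x k)) =
      toUltraproduct U fun i => Structure.funMap F fun k => x k i :=
  Ultraproduct.funMap_cast F x

theorem relMap_toUltraproduct {n : ℕ} (R : L.Relations n) (x : Fin n → ∀ i, N i) :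
    Structure.RelMap R (fun k => toUltraproduct U (x k)) ↔
      ∀ᶠ i in U, Structure.RelMap R fun k => x k i :=
  relMap_quotient_mk' (s := (U : Filter I).productSetoid N) R x

variable (U) in
/-- The ultraproduct of a family of substructures, as a substructure of the ultraproduct. -/
def internalSubstructure (T : ∀ i, L.Substructure (N i)) :
    L.Substructure ((U : Filter I).Product N) where
  carrier := {x | ∃ f : ∀ i, N i, (∀ᶠ i in U, f i ∈ T i) ∧ toUltraproduct U f = x}
  fun_mem {n} F x hx := by
    choose f hf hfx using hx
    refine ⟨fun i => Structure.funMap F fun k => f k i, ?_, ?_⟩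
    · exact (eventually_all.2 hf).mono fun i hi => (T i).fun_mem F _ hi
    · rw [← funMap_toUltraproduct, funext hfx]

variable {S T : ∀ i, L.Substructure (N i)}

theorem toUltraproduct_mem_internalSubstructure {f : ∀ i, N i} :
    toUltraproduct U f ∈ internalSubstructure U T ↔ ∀ᶠ i in U, f i ∈ T i := by
  refine ⟨fun ⟨g, hg, hgf⟩ => ?_, fun hf => ⟨f, hf, rfl⟩⟩
  filter_upwards [hg, toUltraproduct_eq_iff.1 hgf] with i hgi hi
  exact hi ▸ hgi

theorem internalSubstructure_mono (hST : ∀ᶠ i in U, S i ≤ T i) :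
    internalSubstructure U S ≤ internalSubstructure U T := by
  rintro _ ⟨f, hf, rfl⟩
  exact ⟨f, (hST.and hf).mono fun i hi => hi.1 hi.2, rfl⟩

theorem internalSubstructure_congr (hST : ∀ᶠ i in U, S i = T i) :
    internalSubstructure U S = internalSubstructure U T :=
  le_antisymm (internalSubstructure_mono (hST.mono fun _ h => h.le))
    (internalSubstructure_mono (hST.mono fun _ h => h.ge))

end Structure

variable {κ : Cardinal.{u}} [CardinalInterFilter (U : Filter I) κ]

theorem exists_eventually_of_eventually_exists {X : Type u} (hX : #X < κ) {p : I → X → Prop}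
    (h : ∀ᶠ i in U, ∃ x, p i x) : ∃ x, ∀ᶠ i in U, p i x := by
  contrapose! h
  exact (eventually_cardinal_forall hX).2 h

theorem eventually_injective {X : Type u} (hX : #X < κ) {r : X → ∀ i, N i}
    (hr : Function.Injective fun x => toUltraproduct U (r x)) :
    ∀ᶠ i in U, Function.Injective fun x => r x i := by
  refine (eventually_cardinal_forall hX).2 fun x => (eventually_cardinal_forall hX).2 fun y => ?_
  by_cases hxy : x = y
  · exact Eventually.of_forall fun _ _ => hxy
  · have hne : ∀ᶠ i in U, ¬ r x i = r y i :=
      Ultrafilter.eventually_not.2 fun h => hxy (hr (toUltraproduct_eq_iff.2 h))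
    exact hne.mono fun i hi h => absurd h hi

variable [∀ i, L.Structure (N i)] {T : ∀ i, L.Substructure (N i)}

theorem card_internalSubstructure_le {c : Cardinal.{u}} (hc : c < κ) (hT : ∀ i, #(T i) ≤ c) :
    #(internalSubstructure U T) ≤ c := by
  induction c using Cardinal.inductionOn with | _ X
  have j : ∀ i, T i ↪ X := fun i => Classical.choice (hT i)
  choose f hfT hf using fun w : internalSubstructure U T => w.2
  have hconst : ∀ w, ∃ x, ∀ᶠ i in U, ∃ h : f w i ∈ T i, j i ⟨f w i, h⟩ = x := fun w =>
    exists_eventually_of_eventually_exists hc ((hfT w).mono fun i hi => ⟨_, hi, rfl⟩)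
  choose x hx using hconst
  refine mk_le_of_injective (f := x) fun w w' hww' => Subtype.ext ?_
  rw [← hf w, ← hf w', toUltraproduct_eq_iff]
  filter_upwards [hx w, hx w'] with i ⟨h, hi⟩ ⟨h', hi'⟩
  exact congrArg Subtype.val ((j i).injective (hi.trans (hww'.trans hi'.symm)))

/-- Otherwise the counterexamples in the coordinates would form an element of the internal
substructure that is not of the form `r x`. -/
theorem eventually_range_eq [∀ i, Nonempty (N i)] {X : Type u} (hX : #X < κ)
    {r : X → ∀ i, N i}
    (hr : (Set.range fun x => toUltraproduct U (r x)) = (internalSubstructure U T : Set _)) :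
    ∀ᶠ i in U, (Set.range fun x => r x i) = (T i : Set (N i)) := by
  have hsub : ∀ᶠ i in U, ∀ x, r x i ∈ T i := (eventually_cardinal_forall hX).2 fun x =>
    toUltraproduct_mem_internalSubstructure.1 (hr.subset ⟨x, rfl⟩)
  have hsup : ∀ᶠ i in U, ∀ t ∈ T i, ∃ x, r x i = t := by
    by_contra! h
    obtain ⟨f, hf⟩ := Filter.skolem.1 h
    obtain ⟨x, hx⟩ := hr.superset
      (toUltraproduct_mem_internalSubstructure.2 (hf.mono fun i hi => hi.1))
    obtain ⟨i, hi, hxi⟩ := (hf.and (toUltraproduct_eq_iff.1 hx)).exists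
    exact hi.2 x hxi
  filter_upwards [hsub, hsup] with i hi hi'
  exact Set.Subset.antisymm (Set.range_subset_iff.2 hi) hi'

section Embedding

variable {W : Type u}

theorem eventually_forall_tuple (hκ : ℵ₀ < κ) (hW : #W < κ) {R : ℕ → Type u}
    (hR : ∀ n, #(R n) < κ) {p : I → ∀ n, R n → (Fin n → W) → Prop}
    (h : ∀ n s x, ∀ᶠ i in U, p i n s x) : ∀ᶠ i in U, ∀ n s x, p i n s x := by
  have := CardinalInterFilter.toCountableInterFilter (U : Filter I) hκ
  have htuple : ∀ n : ℕ, #(Fin n → W) < κ := fun n => by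
    rw [mk_arrow, mk_fin, lift_natCast, lift_uzero]
    rcases lt_or_ge #W ℵ₀ with hfin | hinf
    · exact (power_lt_aleph0 hfin natCast_lt_aleph0).trans hκ
    · exact (power_nat_le hinf).trans_lt hW
  exact eventually_countable_forall.2 fun n => (eventually_cardinal_forall (hR n)).2 fun s =>
    (eventually_cardinal_forall (htuple n)).2 fun x => h n s x

variable [L.Structure W] {φ : W ↪[L] (U : Filter I).Product N} {r : W → ∀ i, N i}

theorem eventually_funMap_eq (hr : ∀ w, toUltraproduct U (r w) = φ w) {n : ℕ}
    (F : L.Functions n) (x : Fin n → W) :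
    ∀ᶠ i in U, r (Structure.funMap F x) i = Structure.funMap F fun k => r (x k) i := by
  rw [← toUltraproduct_eq_iff, hr, φ.map_fun, ← funMap_toUltraproduct]
  exact congrArg _ (funext fun k => (hr (x k)).symm)

theorem eventually_relMap_iff (hr : ∀ w, toUltraproduct U (r w) = φ w) {n : ℕ}
    (R : L.Relations n) (x : Fin n → W) :
    ∀ᶠ i in U, (Structure.RelMap R fun k => r (x k) i) ↔ Structure.RelMap R x := by
  have hφ : (∀ᶠ i in U, Structure.RelMap R fun k => r (x k) i) ↔ Structure.RelMap R x := by
    rw [← relMap_toUltraproduct, ← φ.map_rel]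
    exact iff_of_eq (congrArg _ (funext fun k => hr (x k)))
  by_cases hx : Structure.RelMap R x
  · exact (hφ.2 hx).mono fun i hi => iff_of_true hi hx
  · exact (Ultrafilter.eventually_not.2 (mt hφ.1 hx)).mono fun i hi => iff_of_false hi hx

theorem eventually_exists_embedding (hκ : ℵ₀ < κ) (hL : L.card < κ) (hW : #W < κ)
    (hr : ∀ w, toUltraproduct U (r w) = φ w) :
    ∀ᶠ i in U, ∃ e : W ↪[L] N i, ∀ w, e w = r w i := by
  have hF : ∀ n, #(L.Functions n) < κ := fun n =>
    (mk_le_of_injective (Sum.inl_injective.comp (sigma_mk_injective (i := n)))).trans_lt hL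
  have hR : ∀ n, #(L.Relations n) < κ := fun n =>
    (mk_le_of_injective (Sum.inr_injective.comp (sigma_mk_injective (i := n)))).trans_lt hL
  have hinj : Function.Injective fun w => toUltraproduct U (r w) := by
    simpa only [hr] using φ.injective
  filter_upwards [eventually_injective hW hinj,
    eventually_forall_tuple hκ hW hF fun n F x => eventually_funMap_eq hr F x,
    eventually_forall_tuple hκ hW hR fun n R x => eventually_relMap_iff hr R x]
    with i hinj hfun hrel
  exact ⟨⟨⟨fun w => r w i, hinj⟩, fun {n} F x => hfun n F x, fun {n} R x => hrel n R x⟩,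
    fun _ => rfl⟩

end Embedding

end Ultraproduct

section LimitEmbedding

open FirstOrder FirstOrder.Language Filter

variable {L : FirstOrder.Language.{u, u}} {I : Type u} {U : Ultrafilter I}
  {N : I → Type u} [∀ i, L.Structure (N i)] [∀ i, Nonempty (N i)]
  {M M' : Type u} [L.Structure M] [L.Structure M'] {A : I → L.Substructure M}
  {A' : I → L.Substructure M'} {g : ∀ i, A i ↪[L] N i} {g' : ∀ i, A' i ↪[L] N i}

open Classical in
variable (g) in
/-- The images of an element under partially defined embeddings, completed by arbitrary values to an
element of the product. -/
noncomputable def limitRep (m : M) (i : I) : N i :=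
  if h : m ∈ A i then g i ⟨m, h⟩ else Classical.arbitrary (N i)

theorem limitRep_of_mem {m : M} {i : I} (h : m ∈ A i) : limitRep g m i = g i ⟨m, h⟩ :=
  dif_pos h

theorem limitRep_tuple_of_mem {n : ℕ} {x : Fin n → M} {i : I} (h : ∀ k, x k ∈ A i) :
    (fun k => limitRep g (x k) i) = fun k => g i ⟨x k, h k⟩ :=
  funext fun k => limitRep_of_mem (h k)

theorem toUltraproduct_limitRep_eq_iff {a : M} {b : M'} (ha : ∀ᶠ i in U, a ∈ A i)
    (hb : ∀ᶠ i in U, b ∈ A' i) :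
    toUltraproduct U (limitRep g a) = toUltraproduct U (limitRep g' b) ↔
      ∀ᶠ i in U, ∃ (h : a ∈ A i) (h' : b ∈ A' i), g i ⟨a, h⟩ = g' i ⟨b, h'⟩ := by
  rw [toUltraproduct_eq_iff]
  refine eventually_congr ((ha.and hb).mono fun i ⟨h, h'⟩ => ?_)
  rw [limitRep_of_mem h, limitRep_of_mem h', exists_prop_of_true h, exists_prop_of_true h']

variable (g) in
/-- The embedding into an ultraproduct induced by embeddings of substructures `A i` such that each
element belongs to almost all `A i`. -/
noncomputable def limitEmbedding (hA : ∀ m, ∀ᶠ i in U, m ∈ A i) :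
    M ↪[L] (U : Filter I).Product N where
  toFun m := toUltraproduct U (limitRep g m)
  inj' a b hab := by
    obtain ⟨i, h, h', hi⟩ := ((toUltraproduct_limitRep_eq_iff (hA a) (hA b)).1 hab).exists
    exact congrArg Subtype.val ((g i).injective hi)
  map_fun' {n} F x := by
    refine Eq.trans (toUltraproduct_eq_iff.2 ?_) (funMap_toUltraproduct F _).symm
    refine (eventually_all.2 fun k => hA (x k)).mono fun i hi => ?_
    rw [limitRep_tuple_of_mem hi, limitRep_of_mem ((A i).fun_mem F x hi)]
    exact (g i).map_fun F fun k => ⟨x k, hi k⟩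
  map_rel' {n} R x := by
    refine (relMap_toUltraproduct R _).trans (Iff.trans (eventually_congr ?_) eventually_const)
    refine (eventually_all.2 fun k => hA (x k)).mono fun i hi => ?_
    rw [limitRep_tuple_of_mem hi]
    exact (g i).map_rel R fun k => ⟨x k, hi k⟩

theorem limitEmbedding_eq_iff (hA : ∀ m, ∀ᶠ i in U, m ∈ A i) (hA' : ∀ m, ∀ᶠ i in U, m ∈ A' i)
    {a : M} {b : M'} :
    limitEmbedding g hA a = limitEmbedding g' hA' b ↔
      ∀ᶠ i in U, ∃ (h : a ∈ A i) (h' : b ∈ A' i), g i ⟨a, h⟩ = g' i ⟨b, h'⟩ :=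
  toUltraproduct_limitRep_eq_iff (hA a) (hA' b)

theorem map_limitEmbedding {κ : Cardinal.{u}} [CardinalInterFilter (U : Filter I) κ]
    (hA : ∀ m, ∀ᶠ i in U, m ∈ A i) {B : L.Substructure M} (hB : #B < κ) :
    B.map (limitEmbedding g hA).toHom =
      internalSubstructure U fun i => (B.comap (A i).subtype.toHom).map (g i).toHom := by
  ext x
  obtain ⟨f, rfl⟩ := toUltraproduct_surjective x
  rw [toUltraproduct_mem_internalSubstructure]
  constructor
  · rintro ⟨b, hb, hbf⟩
    filter_upwards [toUltraproduct_eq_iff.1 hbf, hA b] with i hi hbi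
    exact ⟨⟨b, hbi⟩, hb, (limitRep_of_mem hbi).symm.trans hi⟩
  · intro hf
    have hf' : ∀ᶠ i in U, ∃ b : B, limitRep g b.1 i = f i :=
      hf.mono fun i ⟨a, ha, hai⟩ => ⟨⟨a, ha⟩, (limitRep_of_mem a.2).trans hai⟩
    obtain ⟨b, hb⟩ := exists_eventually_of_eventually_exists hB hf'
    exact ⟨b, b.2, toUltraproduct_eq_iff.2 hb⟩

theorem eventually_subset_of_forall_eventually_mem {κ : Cardinal.{u}}
    [CardinalInterFilter (U : Filter I) κ] (hA : ∀ m, ∀ᶠ i in U, m ∈ A i)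
    {B : L.Substructure M} (hB : #B < κ) : ∀ᶠ i in U, B ≤ A i :=
  ((eventually_cardinal_forall hB).2 fun b : B => hA b).mono fun _ hi b hb => hi ⟨b, hb⟩

end LimitEmbedding

namespace AEC

open FirstOrder FirstOrder.Language FirstOrder.Language.Substructure Filter

variable {L : FirstOrder.Language.{u, u}} {K : AEC L}

section Strong

variable {M N P : Type u} [L.Structure M] [L.Structure N] [L.Structure P]

theorem map_comap_subtype {S T : L.Substructure N} (h : S ≤ T) :
    (S.comap T.subtype.toHom).map T.subtype.toHom = S := by
  ext x
  exact ⟨fun ⟨_, hy, e⟩ => e ▸ hy, fun hx => ⟨⟨x, h hx⟩, hx, rfl⟩⟩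

theorem strong_map_equiv_iff (e : M ≃[L] N) {S : L.Substructure M} :
    K.Strong (S.map e.toHom) ↔ K.Strong S := by
  refine ⟨fun h => ?_, K.strong_of_equiv e S⟩
  have hS : (S.map e.toHom).map e.symm.toHom = S := by
    rw [Substructure.map_map, Equiv.symm_comp_self_toHom, Substructure.map_id]
  exact hS ▸ K.strong_of_equiv e.symm _ h

theorem strongWithin_map_iff (f : M ↪[L] N) {S T : L.Substructure M} :
    StrongWithin K.Strong (S.map f.toHom) (T.map f.toHom) ↔ StrongWithin K.Strong S T := by
  have hcomap : (S.map f.toHom).comap (T.map f.toHom).subtype.toHom =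
      (S.comap T.subtype.toHom).map (f.substructureEquivMap T).toHom := by
    ext ⟨_, t, ht, rfl⟩
    constructor
    · rintro ⟨s, hs, hst⟩
      exact ⟨⟨t, ht⟩, f.injective hst ▸ hs, rfl⟩
    · rintro ⟨s, hs, hst⟩
      exact ⟨s, hs, congrArg Subtype.val hst⟩
  rw [StrongWithin, hcomap, strong_map_equiv_iff, map_le_map_iff_of_injective f.injective]
  rfl

theorem strongWithin_comap_subtype_iff {R S T : L.Substructure N} (hR : R ≤ T) (hS : S ≤ T) :
    StrongWithin K.Strong (R.comap T.subtype.toHom) (S.comap T.subtype.toHom) ↔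
      StrongWithin K.Strong R S := by
  rw [← strongWithin_map_iff T.subtype, map_comap_subtype hR, map_comap_subtype hS]

theorem strongWithin_top_iff {S : L.Substructure N} :
    StrongWithin K.Strong S ⊤ ↔ K.Strong S := by
  rw [StrongWithin, ← strong_map_equiv_iff topEquiv, and_iff_right le_top]
  exact iff_of_eq (congrArg K.Strong (map_comap_subtype le_top))

theorem strongWithin_iff_of_strong {S T : L.Substructure N} (hT : K.Strong T) (hST : S ≤ T) :
    StrongWithin K.Strong S T ↔ K.Strong S :=
  ⟨fun h => K.strong_trans S T h hT, fun h => K.coherence S T h hT hST⟩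

theorem strongWithin_trans {R S T : L.Substructure N} (hRS : StrongWithin K.Strong R S)
    (hST : StrongWithin K.Strong S T) : StrongWithin K.Strong R T :=
  ⟨hRS.1.trans hST.1, (strongWithin_iff_of_strong hST.2 (monotone_comap hRS.1)).1
    ((strongWithin_comap_subtype_iff (hRS.1.trans hST.1) hST.1).2 hRS)⟩

theorem IsKEmbedding.strong_map_iff {f : M ↪[L] N} (hf : K.IsKEmbedding f)
    {S : L.Substructure M} : K.Strong (S.map f.toHom) ↔ K.Strong S := by
  rw [IsKEmbedding, Hom.range_eq_map] at hf
  rw [← strongWithin_iff_of_strong hf (monotone_map le_top), strongWithin_map_iff,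
    strongWithin_top_iff]

theorem IsKEmbedding.comp_iff {f : M ↪[L] N} {g : N ↪[L] P} (hg : K.IsKEmbedding g) :
    K.IsKEmbedding (g.comp f) ↔ K.IsKEmbedding f := by
  rw [IsKEmbedding, Embedding.comp_toHom, Hom.range_comp, hg.strong_map_iff]
  rfl

theorem isKEmbedding_subtype_iff {S : L.Substructure N} :
    K.IsKEmbedding S.subtype ↔ K.Strong S := by
  rw [IsKEmbedding, range_subtype]

theorem isKEmbedding_refl (hM : K.Mod M) : K.IsKEmbedding (Embedding.refl L M) := by
  rw [IsKEmbedding, Hom.range_eq_top.2 Function.surjective_id]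
  exact K.strong_refl hM

theorem IsKEmbedding.codRestrict {f : M ↪[L] N} (hf : K.IsKEmbedding f) {S : L.Substructure N}
    (hS : K.Strong S) (h : ∀ m, f m ∈ S) : K.IsKEmbedding (f.codRestrict S h) := by
  rwa [← (isKEmbedding_subtype_iff.2 hS).comp_iff, Embedding.subtype_comp_codRestrict]

end Strong

section DirectedUnion

variable {N : Type u} [L.Structure N]

/-- The union of the family `S` is its least upper bound for the strong substructure relation. -/
structure IsStrongUnion (K : AEC L) {ι : Type*} (S : ι → L.Substructure N) : Prop where
  strongWithin_iSup : ∀ i, StrongWithin K.Strong (S i) (⨆ i, S i)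
  iSup_strongWithin : ∀ T, (∀ i, StrongWithin K.Strong (S i) T) →
    StrongWithin K.Strong (⨆ i, S i) T

theorem isStrongUnion_of_forall_strongWithin {ι : Type*} {S : ι → L.Substructure N} {i : ι}
    (hi : ∀ j, StrongWithin K.Strong (S j) (S i)) : IsStrongUnion K S := by
  have hS : ⨆ j, S j = S i := le_antisymm (iSup_le fun j => (hi j).1) (le_iSup S i)
  exact ⟨fun j => hS ▸ hi j, fun T hT => hS ▸ hT i⟩

theorem comap_subtype_iSup {ι : Type*} {S : ι → L.Substructure N} {T : L.Substructure N}
    (hS : ∀ i, S i ≤ T) :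
    (⨆ i, S i).comap T.subtype.toHom = ⨆ i, (S i).comap T.subtype.toHom := by
  apply map_injective_of_injective (f := T.subtype.toHom) T.subtype.injective
  simp only [Substructure.map_iSup, map_comap_subtype (iSup_le hS), map_comap_subtype (hS _)]

theorem isStrongUnion_of_continuous_chain {ι : Type u} [LinearOrder ι] [WellFoundedLT ι]
    [Nonempty ι] {S : ι → L.Substructure N}
    (hS : ∀ i j, i ≤ j → StrongWithin K.Strong (S i) (S j))
    (hlim : ∀ i, Order.IsSuccLimit i → S i = ⨆ j : Set.Iio i, S j) : IsStrongUnion K S := by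
  refine ⟨(K.chain_union S hS hlim).2, fun T hT => ⟨iSup_le fun i => (hT i).1, ?_⟩⟩
  rw [comap_subtype_iSup fun i => (hT i).1]
  refine K.chain_union_strong _ (fun i j hij => ?_) (fun i hi => ?_) fun i => (hT i).2
  · exact (strongWithin_comap_subtype_iff (hT i).1 (hT j).1).2 (hS i j hij)
  · rw [hlim i hi, comap_subtype_iSup fun j : Set.Iio i => (hT j).1]

theorem isStrongUnion_of_finset_below {X : Type u} [LinearOrder X] [WellFoundedLT X]
    [NoMaxOrder X] [Nonempty X] {S : Finset X → L.Substructure N}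
    (hbelow : ∀ a : X,
      IsStrongUnion K fun t : Finset {x // x < a} => S (t.map (.subtype _))) :
    IsStrongUnion K S := by
  have hstrong : ∀ s a, (∀ x ∈ s, x < a) →
      StrongWithin K.Strong (S s) (iSupFinsetBelow S a) := fun s a hs => by
    obtain ⟨t, rfl⟩ := exists_finset_map_subtype_eq hs
    exact (hbelow a).strongWithin_iSup t
  have hchain : IsStrongUnion K (iSupFinsetBelow S) :=
    isStrongUnion_of_continuous_chain
      (fun a b hab => (hbelow a).iSup_strongWithin _ fun t =>
        hstrong _ b (Finset.forall_mem_map.2 fun x _ => x.2.trans_le hab))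
      fun a ha => iSupFinsetBelow_of_isSuccLimit S ha
  refine ⟨fun s => ?_, fun T hT => ?_⟩
  · obtain ⟨a, ha⟩ := exists_forall_mem_finset_lt s
    rw [← iSup_iSupFinsetBelow]
    exact strongWithin_trans (hstrong s a ha) (hchain.strongWithin_iSup a)
  · rw [← iSup_iSupFinsetBelow]
    exact hchain.iSup_strongWithin T fun a => (hbelow a).iSup_strongWithin T fun t => hT _

/-- By induction on `#X`: well-order `X` in order type `#X`; the unions of the subfamilies indexed
by the finite subsets of the initial segments of `X` form a continuous chain. -/
theorem isStrongUnion_of_finset {X : Type u} {S : Finset X → L.Substructure N}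
    (hS : ∀ s t, s ⊆ t → StrongWithin K.Strong (S s) (S t)) : IsStrongUnion K S := by
  induction hc : #X using WellFoundedLT.induction generalizing X with
  | ind c ih =>
  subst hc
  rcases finite_or_infinite X with hX | hX
  · have := Fintype.ofFinite X
    exact isStrongUnion_of_forall_strongWithin fun s => hS s _ s.subset_univ
  · obtain ⟨_, _, hord⟩ := exists_ord_eq_type_lt X
    have : NoMaxOrder X := by
      rw [← Ordinal.isSuccPrelimit_type_lt_iff, ← hord]
      exact (isSuccLimit_ord (aleph0_le_mk X)).isSuccPrelimit
    exact isStrongUnion_of_finset_below fun a => ih _ (mk_Iio_lt a hord)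
      (fun s t hst => hS _ _ (Finset.map_subset_map.2 hst)) rfl

theorem isStrongUnion_of_directed {ι : Type u} [Nonempty ι] {S : ι → L.Substructure N}
    (hdir : Directed (· ≤ ·) S)
    (hS : ∀ i j, S i ≤ S j → StrongWithin K.Strong (S i) (S j)) : IsStrongUnion K S := by
  let _ : Preorder ι := Preorder.lift S
  have : IsDirectedOrder ι := ⟨hdir⟩
  obtain ⟨F, hF_mono, hF⟩ := exists_monotone_finset_upperBound ι
  have hle : ∀ i, S i ≤ S (F {i}) := fun i => hF {i} i (Finset.mem_singleton_self i)
  have hunion : ⨆ s, S (F s) = ⨆ i, S i :=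
    le_antisymm (iSup_le fun s => le_iSup S _)
      (iSup_mono' fun i => ⟨{i}, hle i⟩)
  have hFS : IsStrongUnion K fun s => S (F s) :=
    isStrongUnion_of_finset fun s t hst => hS _ _ (hF_mono hst)
  refine ⟨fun i => ?_, fun T hT => ?_⟩
  · exact hunion ▸ strongWithin_trans (hS i _ (hle i)) (hFS.strongWithin_iSup {i})
  · exact hunion ▸ hFS.iSup_strongWithin T fun s => hT _

theorem strong_iSup_of_directed {ι : Type u} [Nonempty ι] {S : ι → L.Substructure N}
    (hdir : Directed (· ≤ ·) S) (hS : ∀ i, K.Strong (S i)) : K.Strong (⨆ i, S i) := by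
  have hunion : IsStrongUnion K S :=
    isStrongUnion_of_directed hdir fun i j => K.coherence _ _ (hS i) (hS j)
  exact strongWithin_top_iff.1
    (hunion.iSup_strongWithin ⊤ fun i => strongWithin_top_iff.2 (hS i))

end DirectedUnion

section LowenheimSkolem

variable {M N : Type u} [L.Structure M] [L.Structure N]

theorem lsNumber_spec (K : AEC L) : ℵ₀ ≤ K.lsNumber ∧ L.card ≤ K.lsNumber ∧
    ∀ (N : Type u) [L.Structure N], K.Mod N → ∀ A : Set N,
      ∃ S : L.Substructure N, K.Strong S ∧ A ⊆ S ∧ #S ≤ #A + K.lsNumber := by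
  refine csInf_mem (s := {lam : Cardinal.{u} | ℵ₀ ≤ lam ∧ L.card ≤ lam ∧
    ∀ (N : Type u) [L.Structure N], K.Mod N → ∀ A : Set N,
      ∃ S : L.Substructure N, K.Strong S ∧ A ⊆ S ∧ #S ≤ #A + lam}) ?_
  obtain ⟨lam, hlam⟩ := K.exists_ls
  refine ⟨max lam (max ℵ₀ L.card), (le_max_left _ _).trans (le_max_right _ _),
    (le_max_right _ _).trans (le_max_right _ _), fun N _ hN A => ?_⟩
  obtain ⟨S, hS, hAS, hcard⟩ := hlam hN A
  exact ⟨S, hS, hAS, hcard.trans (by gcongr; exact le_max_left _ _)⟩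

theorem aleph0_le_lsNumber (K : AEC L) : ℵ₀ ≤ K.lsNumber := K.lsNumber_spec.1

theorem card_le_lsNumber (K : AEC L) : L.card ≤ K.lsNumber := K.lsNumber_spec.2.1

theorem exists_strong_card_le (hN : K.Mod N) (X : Set N) :
    ∃ S : L.Substructure N, K.Strong S ∧ X ⊆ S ∧ #S ≤ #X + K.lsNumber :=
  K.lsNumber_spec.2.2 N hN X

/-- `S` is a strong substructure with cardinality in `C`. -/
def IsStrongOfCard (K : AEC L) (C : Set Cardinal.{u}) (S : L.Substructure N) : Prop :=
  K.Strong S ∧ #S ∈ C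

theorem IsStrongOfCard.mod {C : Set Cardinal.{u}} {S : L.Substructure N}
    (hS : K.IsStrongOfCard C S) : K.Mod S :=
  (K.mod_of_strong S hS.1).1

theorem exists_isStrongOfCard_Ico {κ μ : Cardinal.{u}} (hLS : K.lsNumber < κ) (hμ : μ < κ)
    (hN : K.Mod N) (hμN : μ ≤ #N) {X : Set N} (hX : #X < κ) :
    ∃ S : L.Substructure N, K.IsStrongOfCard (Set.Ico μ κ) S ∧ X ⊆ S := by
  have hκ : ℵ₀ ≤ κ := K.aleph0_le_lsNumber.trans hLS.le
  obtain ⟨Y, rfl⟩ := le_mk_iff_exists_set.1 hμN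
  obtain ⟨S, hS, hXYS, hcard⟩ := exists_strong_card_le hN (X ∪ Y)
  obtain ⟨hXS, hYS⟩ := Set.union_subset_iff.1 hXYS
  have hXY : #(X ∪ Y : Set N) < κ := (mk_union_le X Y).trans_lt (add_lt_of_lt hκ hX hμ)
  exact ⟨S, ⟨hS, mk_le_mk_of_subset hYS, hcard.trans_lt (add_lt_of_lt hκ hXY hLS)⟩, hXS⟩

variable (K N) in
/-- The strong substructures of `N` of cardinality at most the Löwenheim–Skolem number; every model
is their directed union. -/
abbrev SmallStrong : Type u := {S : L.Substructure N // K.Strong S ∧ #S ≤ K.lsNumber}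

theorem exists_smallStrong (hN : K.Mod N) {X : Set N} (hX : #X ≤ K.lsNumber) :
    ∃ S : SmallStrong K N, X ⊆ S.1 := by
  obtain ⟨S, hS, hXS, hcard⟩ := exists_strong_card_le hN X
  exact ⟨⟨S, hS, hcard.trans (add_le_of_le K.aleph0_le_lsNumber hX le_rfl)⟩, hXS⟩

theorem exists_mem_smallStrong (hN : K.Mod N) (x : N) : ∃ S : SmallStrong K N, x ∈ S.1 := by
  have hx : #({x} : Set N) ≤ K.lsNumber :=
    (mk_singleton x).trans_le (one_le_aleph0.trans K.aleph0_le_lsNumber)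
  exact (exists_smallStrong hN hx).imp fun S hS => hS rfl

theorem nonempty_smallStrong (hN : K.Mod N) : Nonempty (SmallStrong K N) :=
  (exists_smallStrong hN (X := ∅) (by simp)).nonempty

theorem isDirectedOrder_smallStrong (hN : K.Mod N) : IsDirectedOrder (SmallStrong K N) := by
  refine ⟨fun S T => ?_⟩
  obtain ⟨V, hV⟩ := exists_smallStrong hN (X := S.1 ∪ T.1)
    ((mk_union_le _ _).trans (add_le_of_le K.aleph0_le_lsNumber S.2.2 T.2.2))
  exact ⟨V, Set.subset_union_left.trans hV, Set.subset_union_right.trans hV⟩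

theorem iSup_smallStrong (hN : K.Mod N) : ⨆ S : SmallStrong K N, S.1 = ⊤ := by
  refine top_le_iff.1 fun x _ => ?_
  obtain ⟨S, hx⟩ := exists_mem_smallStrong hN x
  exact le_iSup (fun S : SmallStrong K N => S.1) S hx

theorem isKEmbedding_of_forall_smallStrong {f : M ↪[L] N} (hM : K.Mod M)
    (hf : ∀ S : SmallStrong K M, K.Strong (S.1.map f.toHom)) : K.IsKEmbedding f := by
  have := nonempty_smallStrong hM
  have := isDirectedOrder_smallStrong hM
  have hdir : Directed (· ≤ ·) fun S : SmallStrong K M => S.1.map f.toHom :=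
    Monotone.directed_le fun S T hST => monotone_map hST
  rw [IsKEmbedding, Hom.range_eq_map, ← iSup_smallStrong hM, Substructure.map_iSup]
  exact strong_iSup_of_directed hdir hf

end LowenheimSkolem

variable {κ μ : Cardinal.{u}}

section Ultraproduct

variable {I : Type u} {U : Ultrafilter I} {N : I → Type u} [∀ i, L.Structure (N i)]

variable (U) in
theorem directed_internalSubstructure (hN : ∀ i, K.Mod (N i)) :
    Directed (· ≤ ·) fun T : ∀ i, SmallStrong K (N i) =>
      internalSubstructure U fun i => (T i).1 := by
  intro S T
  have := fun i => isDirectedOrder_smallStrong (hN i)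
  choose V hSV hTV using fun i => exists_ge_ge (S i) (T i)
  exact ⟨V, internalSubstructure_mono (Eventually.of_forall hSV),
    internalSubstructure_mono (Eventually.of_forall hTV)⟩

theorem iSup_internalSubstructure (hN : ∀ i, K.Mod (N i)) :
    ⨆ T : ∀ i, SmallStrong K (N i), internalSubstructure U (fun i => (T i).1) = ⊤ := by
  refine top_le_iff.1 fun x _ => ?_
  obtain ⟨f, rfl⟩ := toUltraproduct_surjective x
  choose T hT using fun i => exists_mem_smallStrong (hN i) (f i)
  exact le_iSup (fun T : ∀ i, SmallStrong K (N i) => internalSubstructure U fun i => (T i).1) T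
    (toUltraproduct_mem_internalSubstructure.2 (Eventually.of_forall hT))

variable [CardinalInterFilter (U : Filter I) κ] [∀ i, Nonempty (N i)]

/-- Both sides have size less than `κ`, so a choice of representatives copies them, as the pair
`S i ≤ T i`, into almost every coordinate, where coherence applies. -/
theorem strongWithin_internalSubstructure (hLS : K.lsNumber < κ)
    {S T : ∀ i, SmallStrong K (N i)}
    (hST : internalSubstructure U (fun i => (S i).1) ≤
      internalSubstructure U fun i => (T i).1) :
    StrongWithin K.Strong (internalSubstructure U fun i => (S i).1)
      (internalSubstructure U fun i => (T i).1) := by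
  set V := internalSubstructure U fun i => (S i).1
  set W := internalSubstructure U fun i => (T i).1
  have hW : #W < κ := (card_internalSubstructure_le hLS fun i => (T i).2.2).trans_lt hLS
  have hV : #V < κ := (mk_le_mk_of_subset hST).trans_lt hW
  choose r hr using fun w : W => toUltraproduct_surjective w.1
  have hrange : (Set.range fun v : V => toUltraproduct U (r (inclusion hST v))) = V := by
    simp only [hr]
    exact Subtype.range_coe
  obtain ⟨i, ⟨e, he⟩, hVS, hWT⟩ := ((eventually_exists_embedding (φ := W.subtype)
    (K.aleph0_le_lsNumber.trans_lt hLS) (K.card_le_lsNumber.trans_lt hLS) hW hr).and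
    ((eventually_range_eq hV hrange).and
      (eventually_range_eq hW ((funext hr : _ = Subtype.val) ▸ Subtype.range_coe)))).exists
  have hS : (V.comap W.subtype.toHom).map e.toHom = (S i).1 := by
    refine SetLike.coe_injective (Eq.trans (Set.ext fun x => ⟨?_, ?_⟩) hVS)
    · rintro ⟨w, hw, rfl⟩
      exact ⟨⟨w, hw⟩, (he w).symm⟩
    · rintro ⟨v, rfl⟩
      exact ⟨inclusion hST v, v.2, he _⟩
  have hT : (⊤ : L.Substructure W).map e.toHom = (T i).1 := by
    refine SetLike.coe_injective (Eq.trans (Set.ext fun x => ⟨?_, ?_⟩) hWT)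
    · rintro ⟨w, -, rfl⟩
      exact ⟨w, (he w).symm⟩
    · rintro ⟨w, rfl⟩
      exact ⟨w, mem_top w, he w⟩
  have hle : (S i).1 ≤ (T i).1 := hS ▸ hT ▸ monotone_map le_top
  have hcoh := K.coherence _ _ (S i).2.1 (T i).2.1 hle
  rw [← hS, ← hT, strongWithin_map_iff, strongWithin_top_iff] at hcoh
  exact ⟨hST, hcoh⟩

theorem strong_internalSubstructure (hLS : K.lsNumber < κ) (hN : ∀ i, K.Mod (N i))
    {T : ∀ i, L.Substructure (N i)}
    (hT : ∀ᶠ i in U, K.Strong (T i) ∧ #(T i) ≤ K.lsNumber) :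
    K.Strong (internalSubstructure U T) := by
  have := fun i => nonempty_smallStrong (hN i)
  have hT' : ∀ᶠ i in U, ∃ S : SmallStrong K (N i), T i = S.1 := hT.mono fun i hi => ⟨⟨_, hi⟩, rfl⟩
  obtain ⟨S, hS⟩ := Filter.skolem.1 hT'
  have hunion := isStrongUnion_of_directed (directed_internalSubstructure U hN)
    fun _ _ => strongWithin_internalSubstructure hLS
  rw [internalSubstructure_congr hS, ← strongWithin_top_iff, ← iSup_internalSubstructure hN]
  exact hunion.strongWithin_iSup S

theorem isKEmbedding_limitEmbedding {M : Type u} [L.Structure M] {A : I → L.Substructure M}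
    {g : ∀ i, A i ↪[L] N i} (hLS : K.lsNumber < κ) (hM : K.Mod M) (hA : ∀ i, K.Strong (A i))
    (hmem : ∀ m, ∀ᶠ i in U, m ∈ A i) (hg : ∀ i, K.IsKEmbedding (g i)) :
    K.IsKEmbedding (limitEmbedding g hmem) := by
  refine isKEmbedding_of_forall_smallStrong hM fun B => ?_
  have hB : #B.1 < κ := B.2.2.trans_lt hLS
  rw [map_limitEmbedding hmem hB]
  refine strong_internalSubstructure hLS (fun i => (K.mod_of_strong _ (hg i)).2) ?_
  filter_upwards [eventually_subset_of_forall_eventually_mem hmem hB] with i hi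
  have hcard : #(B.1.comap (A i).subtype.toHom) ≤ #B.1 :=
    mk_preimage_of_injective _ _ Subtype.val_injective
  exact ⟨(hg i).strong_map_iff.2 (K.coherence _ _ B.2.1 (hA i) hi).2,
    mk_image_le.trans (hcard.trans B.2.2)⟩

end Ultraproduct

section JointlyEmbeds

/-- `M₁` and `M₂` have `K`-embeddings into a common model that identify `a : M₁` with `b : M₂`
whenever `F a b`, and only if `E a b`. The amalgamation and joint embedding properties are all of
this form. -/
def JointlyEmbeds (K : AEC L) (M₁ M₂ : Type u) [L.Structure M₁] [L.Structure M₂]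
    (F E : M₁ → M₂ → Prop) : Prop :=
  ∃ (N : Type u) (_ : L.Structure N) (g₁ : M₁ ↪[L] N) (g₂ : M₂ ↪[L] N),
    K.IsKEmbedding g₁ ∧ K.IsKEmbedding g₂ ∧
    (∀ a b, F a b → g₁ a = g₂ b) ∧ ∀ a b, g₁ a = g₂ b → E a b

variable {M₁ M₂ : Type u} [L.Structure M₁] [L.Structure M₂] {F E : M₁ → M₂ → Prop}

theorem JointlyEmbeds.mono {F' E' : M₁ → M₂ → Prop} (h : K.JointlyEmbeds M₁ M₂ F E)
    (hF : ∀ a b, F' a b → F a b) (hE : ∀ a b, E a b → E' a b) :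
    K.JointlyEmbeds M₁ M₂ F' E' := by
  obtain ⟨N, _, g₁, g₂, hg₁, hg₂, hgF, hgE⟩ := h
  exact ⟨N, _, g₁, g₂, hg₁, hg₂, fun a b hab => hgF a b (hF a b hab),
    fun a b hab => hE a b (hgE a b hab)⟩

theorem JointlyEmbeds.comp {P₁ P₂ : Type u} [L.Structure P₁] [L.Structure P₂]
    (h : K.JointlyEmbeds M₁ M₂ F E) {e₁ : P₁ ↪[L] M₁} {e₂ : P₂ ↪[L] M₂}
    (he₁ : K.IsKEmbedding e₁) (he₂ : K.IsKEmbedding e₂) :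
    K.JointlyEmbeds P₁ P₂ (fun a b => F (e₁ a) (e₂ b)) fun a b => E (e₁ a) (e₂ b) := by
  obtain ⟨N, _, g₁, g₂, hg₁, hg₂, hF, hE⟩ := h
  exact ⟨N, _, g₁.comp e₁, g₂.comp e₂, hg₁.comp_iff.2 he₁, hg₂.comp_iff.2 he₂,
    fun a b => hF (e₁ a) (e₂ b), fun a b => hE (e₁ a) (e₂ b)⟩

theorem jointlyEmbeds_of_eventually {I : Type u} {U : Ultrafilter I}
    [CardinalInterFilter (U : Filter I) κ] (hLS : K.lsNumber < κ) (hM₁ : K.Mod M₁)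
    (hM₂ : K.Mod M₂) {A₁ : I → L.Substructure M₁} {A₂ : I → L.Substructure M₂}
    [∀ i, Nonempty (A₁ i ⊕ A₂ i)] (hA₁ : ∀ i, K.Strong (A₁ i)) (hA₂ : ∀ i, K.Strong (A₂ i))
    (hmem₁ : ∀ a, ∀ᶠ i in U, a ∈ A₁ i) (hmem₂ : ∀ b, ∀ᶠ i in U, b ∈ A₂ i)
    {F' : I → M₁ → M₂ → Prop} (hF' : ∀ a b, F a b → ∀ᶠ i in U, F' i a b)
    (h : ∀ i, K.JointlyEmbeds (A₁ i) (A₂ i) (fun a b => F' i a b) fun a b => E a b) :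
    K.JointlyEmbeds M₁ M₂ F E := by
  choose N _ g₁ g₂ hg₁ hg₂ hF hE using h
  have : ∀ i, Nonempty (N i) := fun i => Nonempty.map (Sum.elim (g₁ i) (g₂ i)) inferInstance
  refine ⟨_, _, limitEmbedding g₁ hmem₁, limitEmbedding g₂ hmem₂,
    isKEmbedding_limitEmbedding hLS hM₁ hA₁ hmem₁ hg₁,
    isKEmbedding_limitEmbedding hLS hM₂ hA₂ hmem₂ hg₂, fun a b hab => ?_, fun a b hab => ?_⟩
  · rw [limitEmbedding_eq_iff]
    filter_upwards [hmem₁ a, hmem₂ b, hF' a b hab] with i ha hb hi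
    exact ⟨ha, hb, hF i ⟨a, ha⟩ ⟨b, hb⟩ hi⟩
  · obtain ⟨i, ha, hb, hi⟩ := ((limitEmbedding_eq_iff hmem₁ hmem₂).1 hab).exists
    exact hE i ⟨a, ha⟩ ⟨b, hb⟩ hi

theorem jointlyEmbeds_of_forall_card_lt (hκ : IsStronglyCompact κ) (hLS : K.lsNumber < κ)
    (hM₁ : K.Mod M₁) (hM₂ : K.Mod M₂)
    (h : ∀ (Y₁ : Set M₁) (Y₂ : Set M₂), #Y₁ < κ → #Y₂ < κ →
      ∃ (A₁ : L.Substructure M₁) (A₂ : L.Substructure M₂), K.Strong A₁ ∧ K.Strong A₂ ∧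
        Y₁ ⊆ A₁ ∧ Y₂ ⊆ A₂ ∧ K.JointlyEmbeds A₁ A₂
          (fun a b => a.1 ∈ Y₁ ∧ b.1 ∈ Y₂ ∧ F a b) fun a b => E a b) :
    K.JointlyEmbeds M₁ M₂ F E := by
  have hω := hκ.aleph0_lt
  rcases isEmpty_or_nonempty (M₁ ⊕ M₂) with hempty | ⟨⟨z⟩⟩
  · obtain ⟨_, _⟩ := isEmpty_sum.1 hempty
    obtain ⟨A₁, A₂, hA₁, hA₂, -, -, hA⟩ := h ∅ ∅ (by simpa using aleph0_pos.trans hω)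
      (by simpa using aleph0_pos.trans hω)
    exact (hA.comp ((isKEmbedding_refl hM₁).codRestrict hA₁ isEmptyElim)
      ((isKEmbedding_refl hM₂).codRestrict hA₂ isEmptyElim)).mono isEmptyElim isEmptyElim
  obtain ⟨U, _, hU⟩ := hκ.exists_fine_ultrafilter (M₁ ⊕ M₂)
  -- Adding `z` ensures that the models indexed by `Y` are nonempty.
  have hcard : ∀ Y : SmallSubset κ (M₁ ⊕ M₂), #(insert z Y.1 : Set (M₁ ⊕ M₂)) < κ :=
    fun Y => mk_insert_le.trans_lt (add_lt_of_lt hω.le Y.2 (one_lt_aleph0.trans hω))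
  choose A₁ A₂ hA₁ hA₂ hY₁ hY₂ hA using fun Y : SmallSubset κ (M₁ ⊕ M₂) =>
    h (Sum.inl ⁻¹' insert z Y.1) (Sum.inr ⁻¹' insert z Y.1)
      ((mk_preimage_of_injective _ _ Sum.inl_injective).trans_lt (hcard Y))
      ((mk_preimage_of_injective _ _ Sum.inr_injective).trans_lt (hcard Y))
  have hne : ∀ Y, Nonempty (A₁ Y ⊕ A₂ Y) := fun Y => by
    rcases z with a | b
    · exact ⟨.inl ⟨a, hY₁ Y (Set.mem_insert _ _)⟩⟩
    · exact ⟨.inr ⟨b, hY₂ Y (Set.mem_insert _ _)⟩⟩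
  have hins : ∀ x, ∀ᶠ Y : SmallSubset κ _ in U, x ∈ insert z Y.1 := fun x =>
    (hU x).mono fun _ => Set.mem_insert_of_mem z
  exact jointlyEmbeds_of_eventually hLS hM₁ hM₂ hA₁ hA₂
    (F' := fun Y a b => .inl a ∈ insert z Y.1 ∧ .inr b ∈ insert z Y.1 ∧ F a b)
    (fun a => (hins (.inl a)).mono fun Y ha => hY₁ Y ha)
    (fun b => (hins (.inr b)).mono fun Y hb => hY₂ Y hb)
    (fun a b hab => ((hins (.inl a)).and (hins (.inr b))).mono fun Y hY => ⟨hY.1, hY.2, hab⟩) hA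

theorem jointlyEmbeds_bot_of_Ico (hκ : IsStronglyCompact κ) (hLS : K.lsNumber < κ) (hμ : μ < κ)
    (hM₁ : K.Mod M₁) (hM₂ : K.Mod M₂) (hμ₁ : μ ≤ #M₁) (hμ₂ : μ ≤ #M₂)
    (h : ∀ (A₁ : L.Substructure M₁) (A₂ : L.Substructure M₂),
      K.IsStrongOfCard (Set.Ico μ κ) A₁ → K.IsStrongOfCard (Set.Ico μ κ) A₂ →
      K.JointlyEmbeds A₁ A₂ ⊥ fun a b => E a b) :
    K.JointlyEmbeds M₁ M₂ ⊥ E := by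
  refine jointlyEmbeds_of_forall_card_lt hκ hLS hM₁ hM₂ fun Y₁ Y₂ hY₁ hY₂ => ?_
  obtain ⟨A₁, hA₁, hYA₁⟩ := exists_isStrongOfCard_Ico hLS hμ hM₁ hμ₁ hY₁
  obtain ⟨A₂, hA₂, hYA₂⟩ := exists_isStrongOfCard_Ico hLS hμ hM₂ hμ₂ hY₂
  exact ⟨A₁, A₂, hA₁.1, hA₂.1, hYA₁, hYA₂,
    (h A₁ A₂ hA₁ hA₂).mono (fun _ _ hF => hF.2.2) fun _ _ => id⟩

end JointlyEmbeds

section Span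

variable {M₀ M₁ M₂ : Type u} [L.Structure M₀] [L.Structure M₁] [L.Structure M₂]

/-- The identifications that a span `M₁ ← M₀ → M₂` imposes on an amalgam. -/
def SpanRel (f₁ : M₀ ↪[L] M₁) (f₂ : M₀ ↪[L] M₂) (a : M₁) (b : M₂) : Prop :=
  ∃ m, f₁ m = a ∧ f₂ m = b

theorem jointlyEmbeds_spanRel_of_Ico {f₁ : M₀ ↪[L] M₁} {f₂ : M₀ ↪[L] M₂}
    {E : M₁ → M₂ → Prop} (hκ : IsStronglyCompact κ) (hLS : K.lsNumber < κ) (hμ : μ < κ)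
    (hM₀ : K.Mod M₀) (hM₁ : K.Mod M₁) (hM₂ : K.Mod M₂) (hμ₀ : μ ≤ #M₀) (hμ₁ : μ ≤ #M₁)
    (hμ₂ : μ ≤ #M₂) (hf₁ : K.IsKEmbedding f₁) (hf₂ : K.IsKEmbedding f₂)
    (h : ∀ (A₀ : L.Substructure M₀) (A₁ : L.Substructure M₁) (A₂ : L.Substructure M₂),
      K.IsStrongOfCard (Set.Ico μ κ) A₀ → K.IsStrongOfCard (Set.Ico μ κ) A₁ →
      K.IsStrongOfCard (Set.Ico μ κ) A₂ → ∀ (e₁ : A₀ ↪[L] A₁) (e₂ : A₀ ↪[L] A₂),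
      K.IsKEmbedding e₁ → K.IsKEmbedding e₂ → (∀ m, (e₁ m : M₁) = f₁ m) →
      (∀ m, (e₂ m : M₂) = f₂ m) → K.JointlyEmbeds A₁ A₂ (SpanRel e₁ e₂) fun a b => E a b) :
    K.JointlyEmbeds M₁ M₂ (SpanRel f₁ f₂) E := by
  refine jointlyEmbeds_of_forall_card_lt hκ hLS hM₁ hM₂ fun Y₁ Y₂ hY₁ hY₂ => ?_
  obtain ⟨A₀, hA₀, hYA₀⟩ := exists_isStrongOfCard_Ico hLS hμ hM₀ hμ₀
    ((mk_preimage_of_injective f₁ Y₁ f₁.injective).trans_lt hY₁)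
  have hunion : ∀ {M : Type u} {Y : Set M} (f : M₀ → M), #Y < κ → #(Y ∪ f '' A₀ : Set M) < κ :=
    fun f hY => (mk_union_le _ _).trans_lt
      (add_lt_of_lt hκ.aleph0_lt.le hY (mk_image_le.trans_lt hA₀.2.2))
  obtain ⟨A₁, hA₁, hYA₁⟩ := exists_isStrongOfCard_Ico hLS hμ hM₁ hμ₁ (hunion f₁ hY₁)
  obtain ⟨A₂, hA₂, hYA₂⟩ := exists_isStrongOfCard_Ico hLS hμ hM₂ hμ₂ (hunion f₂ hY₂)
  have hfA₁ : ∀ m : A₀, f₁ m ∈ A₁ := fun m => hYA₁ (.inr ⟨m, m.2, rfl⟩)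
  have hfA₂ : ∀ m : A₀, f₂ m ∈ A₂ := fun m => hYA₂ (.inr ⟨m, m.2, rfl⟩)
  have hA₀' : K.IsKEmbedding A₀.subtype := isKEmbedding_subtype_iff.2 hA₀.1
  have hA := h A₀ A₁ A₂ hA₀ hA₁ hA₂ ((f₁.comp A₀.subtype).codRestrict A₁ hfA₁)
    ((f₂.comp A₀.subtype).codRestrict A₂ hfA₂) ((hf₁.comp_iff.2 hA₀').codRestrict hA₁.1 hfA₁)
    ((hf₂.comp_iff.2 hA₀').codRestrict hA₂.1 hfA₂) (fun _ => rfl) fun _ => rfl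
  refine ⟨A₁, A₂, hA₁.1, hA₂.1, Set.subset_union_left.trans hYA₁,
    Set.subset_union_left.trans hYA₂, hA.mono ?_ fun _ _ => id⟩
  rintro a b ⟨ha, -, m, hma, hmb⟩
  exact ⟨⟨m, hYA₀ (hma ▸ ha : f₁ m ∈ Y₁)⟩, Subtype.ext hma, Subtype.ext hmb⟩

end Span

section Properties

variable {M₀ M₁ M₂ : Type u} [L.Structure M₀] [L.Structure M₁] [L.Structure M₂]
  {f₁ : M₀ ↪[L] M₁} {f₂ : M₀ ↪[L] M₂}

theorem jointlyEmbeds_bot_top_iff :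
    K.JointlyEmbeds M₁ M₂ ⊥ ⊤ ↔
      ∃ (N : Type u) (_ : L.Structure N) (g₁ : M₁ ↪[L] N) (g₂ : M₂ ↪[L] N),
        K.IsKEmbedding g₁ ∧ K.IsKEmbedding g₂ := by
  simp [JointlyEmbeds]

theorem jointlyEmbeds_bot_bot_iff :
    K.JointlyEmbeds M₁ M₂ ⊥ ⊥ ↔
      ∃ (N : Type u) (_ : L.Structure N) (g₁ : M₁ ↪[L] N) (g₂ : M₂ ↪[L] N),
        K.IsKEmbedding g₁ ∧ K.IsKEmbedding g₂ ∧ Disjoint (Set.range g₁) (Set.range g₂) := by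
  simp [JointlyEmbeds, Set.disjoint_range_iff]

theorem mem_closure_empty_iff (f : M₁ ↪[L] M₂) {m : M₁} :
    f m ∈ closure L (∅ : Set M₂) ↔ m ∈ closure L (∅ : Set M₁) := by
  rw [← Set.image_empty f, ← Embedding.coe_toHom, closure_image]
  exact ⟨fun ⟨m', hm', h⟩ => f.injective h ▸ hm', fun h => ⟨m, h, rfl⟩⟩

theorem jointlyEmbeds_bot_closure_iff :
    K.JointlyEmbeds M₁ M₂ ⊥ (fun a _ => a ∈ closure L (∅ : Set M₁)) ↔
      ∃ (N : Type u) (_ : L.Structure N) (g₁ : M₁ ↪[L] N) (g₂ : M₂ ↪[L] N),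
        K.IsKEmbedding g₁ ∧ K.IsKEmbedding g₂ ∧
        Set.range g₁ ∩ Set.range g₂ ⊆ (closure L (∅ : Set N) : Set N) := by
  refine exists₄_congr fun N _ g₁ g₂ => and_congr_right fun _ => and_congr_right fun _ => ?_
  refine (and_iff_right fun _ _ => False.elim).trans ⟨?_, fun h a b hab => ?_⟩
  · rintro h _ ⟨⟨a, rfl⟩, b, hb⟩
    exact (mem_closure_empty_iff g₁).2 (h a b hb.symm)
  · exact (mem_closure_empty_iff g₁).1 (h ⟨⟨a, rfl⟩, b, hab.symm⟩)

theorem forall_spanRel_iff {N : Type u} [L.Structure N] {g₁ : M₁ ↪[L] N} {g₂ : M₂ ↪[L] N} :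
    (∀ a b, SpanRel f₁ f₂ a b → g₁ a = g₂ b) ↔ g₁.comp f₁ = g₂.comp f₂ := by
  refine ⟨fun h => Embedding.ext fun m => h _ _ ⟨m, rfl, rfl⟩, ?_⟩
  rintro h _ _ ⟨m, rfl, rfl⟩
  exact DFunLike.congr_fun h m

theorem jointlyEmbeds_spanRel_top_iff :
    K.JointlyEmbeds M₁ M₂ (SpanRel f₁ f₂) ⊤ ↔
      ∃ (N : Type u) (_ : L.Structure N) (g₁ : M₁ ↪[L] N) (g₂ : M₂ ↪[L] N),
        K.IsKEmbedding g₁ ∧ K.IsKEmbedding g₂ ∧ g₁.comp f₁ = g₂.comp f₂ := by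
  simp [JointlyEmbeds, forall_spanRel_iff]

theorem forall_eq_imp_spanRel_iff {N : Type u} [L.Structure N] {g₁ : M₁ ↪[L] N}
    {g₂ : M₂ ↪[L] N} (h : g₁.comp f₁ = g₂.comp f₂) :
    (∀ a b, g₁ a = g₂ b → SpanRel f₁ f₂ a b) ↔
      Set.range g₁ ∩ Set.range g₂ = Set.range (g₁.comp f₁) := by
  have hle : Set.range (g₁.comp f₁) ⊆ Set.range g₁ ∩ Set.range g₂ := by
    rintro _ ⟨m, rfl⟩
    exact ⟨⟨f₁ m, rfl⟩, f₂ m, (DFunLike.congr_fun h m).symm⟩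
  refine ⟨fun hE => Set.Subset.antisymm ?_ hle, fun hE a b hab => ?_⟩
  · rintro _ ⟨⟨a, rfl⟩, b, hb⟩
    obtain ⟨m, rfl, -⟩ := hE a b hb.symm
    exact ⟨m, rfl⟩
  · obtain ⟨m, hm⟩ := hE.subset ⟨⟨a, rfl⟩, b, hab.symm⟩
    have hm₂ : g₂ (f₂ m) = g₂ b := (DFunLike.congr_fun h m).symm.trans (hm.trans hab)
    exact ⟨m, g₁.injective hm, g₂.injective hm₂⟩

theorem jointlyEmbeds_spanRel_spanRel_iff :
    K.JointlyEmbeds M₁ M₂ (SpanRel f₁ f₂) (SpanRel f₁ f₂) ↔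
      ∃ (N : Type u) (_ : L.Structure N) (g₁ : M₁ ↪[L] N) (g₂ : M₂ ↪[L] N),
        K.IsKEmbedding g₁ ∧ K.IsKEmbedding g₂ ∧ g₁.comp f₁ = g₂.comp f₂ ∧
        Set.range g₁ ∩ Set.range g₂ = Set.range (g₁.comp f₁) := by
  refine exists₄_congr fun N _ g₁ g₂ => and_congr_right fun _ => and_congr_right fun _ => ?_
  rw [forall_spanRel_iff]
  exact and_congr_right forall_eq_imp_spanRel_iff

theorem JEP.of_Ico (hκ : IsStronglyCompact κ) (hLS : K.lsNumber < κ) (hμ : μ < κ)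
    (h : K.JEP (Set.Ico μ κ)) : K.JEP (Set.Ici μ) := by
  intro M₁ M₂ _ _ hM₁ hM₂ hμ₁ hμ₂
  exact jointlyEmbeds_bot_top_iff.1 <| jointlyEmbeds_bot_of_Ico hκ hLS hμ hM₁ hM₂ hμ₁ hμ₂
    fun A₁ A₂ hA₁ hA₂ => jointlyEmbeds_bot_top_iff.2 (h A₁ A₂ hA₁.mod hA₂.mod hA₁.2 hA₂.2)

theorem DJEP.of_Ico (hκ : IsStronglyCompact κ) (hLS : K.lsNumber < κ) (hμ : μ < κ)
    (h : K.DJEP (Set.Ico μ κ)) : K.DJEP (Set.Ici μ) := by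
  intro M₁ M₂ _ _ hM₁ hM₂ hμ₁ hμ₂
  exact jointlyEmbeds_bot_bot_iff.1 <| jointlyEmbeds_bot_of_Ico hκ hLS hμ hM₁ hM₂ hμ₁ hμ₂
    fun A₁ A₂ hA₁ hA₂ => jointlyEmbeds_bot_bot_iff.2 (h A₁ A₂ hA₁.mod hA₂.mod hA₁.2 hA₂.2)

theorem NDJEP.of_Ico (hκ : IsStronglyCompact κ) (hLS : K.lsNumber < κ) (hμ : μ < κ)
    (h : K.NDJEP (Set.Ico μ κ)) : K.NDJEP (Set.Ici μ) := by
  intro M₁ M₂ _ _ hM₁ hM₂ hμ₁ hμ₂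
  refine jointlyEmbeds_bot_closure_iff.1 <| jointlyEmbeds_bot_of_Ico hκ hLS hμ hM₁ hM₂ hμ₁ hμ₂
    fun A₁ A₂ hA₁ hA₂ => ?_
  have hA := jointlyEmbeds_bot_closure_iff.2 (h A₁ A₂ hA₁.mod hA₂.mod hA₁.2 hA₂.2)
  exact hA.mono (fun _ _ => id) fun a _ => (mem_closure_empty_iff A₁.subtype).2

theorem AP.of_Ico (hκ : IsStronglyCompact κ) (hLS : K.lsNumber < κ) (hμ : μ < κ)
    (h : K.AP (Set.Ico μ κ)) : K.AP (Set.Ici μ) := by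
  intro M₀ M₁ M₂ _ _ _ hM₀ hM₁ hM₂ hμ₀ hμ₁ hμ₂ f₁ f₂ hf₁ hf₂
  refine jointlyEmbeds_spanRel_top_iff.1 <| jointlyEmbeds_spanRel_of_Ico hκ hLS hμ hM₀ hM₁ hM₂
    hμ₀ hμ₁ hμ₂ hf₁ hf₂ fun A₀ A₁ A₂ hA₀ hA₁ hA₂ e₁ e₂ he₁ he₂ _ _ => ?_
  exact jointlyEmbeds_spanRel_top_iff.2
    (h A₀ A₁ A₂ hA₀.mod hA₁.mod hA₂.mod hA₀.2 hA₁.2 hA₂.2 e₁ e₂ he₁ he₂)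

theorem DAP.of_Ico (hκ : IsStronglyCompact κ) (hLS : K.lsNumber < κ) (hμ : μ < κ)
    (h : K.DAP (Set.Ico μ κ)) : K.DAP (Set.Ici μ) := by
  intro M₀ M₁ M₂ _ _ _ hM₀ hM₁ hM₂ hμ₀ hμ₁ hμ₂ f₁ f₂ hf₁ hf₂
  refine jointlyEmbeds_spanRel_spanRel_iff.1 <| jointlyEmbeds_spanRel_of_Ico hκ hLS hμ hM₀ hM₁ hM₂
    hμ₀ hμ₁ hμ₂ hf₁ hf₂ fun A₀ A₁ A₂ hA₀ hA₁ hA₂ e₁ e₂ he₁ he₂ hef₁ hef₂ => ?_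
  have hA := jointlyEmbeds_spanRel_spanRel_iff.2
    (h A₀ A₁ A₂ hA₀.mod hA₁.mod hA₂.mod hA₀.2 hA₁.2 hA₂.2 e₁ e₂ he₁ he₂)
  refine hA.mono (fun _ _ => id) ?_
  rintro _ _ ⟨m, rfl, rfl⟩
  exact ⟨m, (hef₁ m).symm, (hef₂ m).symm⟩

end Properties

end AEC

theorem theorem1p1 (L : FirstOrder.Language.{u, u}) (K : AEC L) (κ μ : Cardinal.{u})
    (hκ : IsStronglyCompact κ) (hLS : K.lsNumber < κ) (hμ : μ < κ) :
    (K.AP (Set.Ico μ κ) → K.AP (Set.Ici μ)) ∧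
    (K.JEP (Set.Ico μ κ) → K.JEP (Set.Ici μ)) ∧
    (K.DAP (Set.Ico μ κ) → K.DAP (Set.Ici μ)) ∧
    (K.DJEP (Set.Ico μ κ) → K.DJEP (Set.Ici μ)) ∧
    (K.NDJEP (Set.Ico μ κ) → K.NDJEP (Set.Ici μ)) :=
  ⟨.of_Ico hκ hLS hμ, .of_Ico hκ hLS hμ, .of_Ico hκ hLS hμ, .of_Ico hκ hLS hμ, .of_Ico hκ hLS hμ⟩
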